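/- Write $\sigma_z=\begin{pmatrix}1&0\\0&-1\end{pmatrix}$ and $H=\tfrac1{\sqrt2}\begin{pmatrix}1&1\\1&-1\end{pmatrix}$. For real phases $\Phi=(\phi_0,\dots,\phi_k)$ and a single-qubit ($2\times2$) unitary $U$, let $$\Phi[U]=e^{i\phi_0\sigma_z}\prod_{j=1}^{k}\bigl(U\,e^{i\phi_j\sigma_z}\bigr)$$ (factors ordered from left to right), and define the associated $\sigma_z$-QSP protocol of length $k$ by $\Phi'[U]=H\,\Phi[HUH]\,H$; it makes $k$ calls to $U$ and uses no ancilla qubit. **Theorem (Existence of an approximating QSP polynomial).** There is an absolute constant $C>0$ such that for every integer $n\ge 0$ and all real $0<\delta\le 1$ and $0<\varepsilon\le \tfrac12$ there exist an integer $k\ge 0$ with $$k\le C\,\delta^{-2}\log\bigl(\varepsilon^{-2}\delta^{-1/2}\bigr)$$ and phases $\Phi\in\mathbb{R}^{k+1}$ such that, for all $\varphi\in[-\pi,\pi]$ with $\cos\varphi\in[\delta,1]$, $$\bigl\|\Phi'[e^{i\varphi\sigma_z}]-e^{i\varphi\sigma_z/2^n}\bigr\|\le\varepsilon,$$ where $\|\cdot\|$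 is the spectral norm. (The phases depend on $n,\delta,\varepsilon$ only, not on $\varphi$.) -/

import Mathlib

open scoped Matrix.Norms.L2Operator

/-- The Pauli matrix `σ_z`. -/
def pauliZ : Matrix (Fin 2) (Fin 2) ℂ := !![1, 0; 0, -1]

/-- The Hadamard gate `H`. -/
noncomputable def hadamardGate : Matrix (Fin 2) (Fin 2) ℂ :=
  ((1 / Real.sqrt 2 : ℝ) : ℂ) • !![1, 1; 1, -1]

/-- The rotation `e^{i θ σ_z}`, a matrix exponential. -/
noncomputable def zRotation (θ : ℝ) : Matrix (Fin 2) (Fin 2) ℂ :=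
  NormedSpace.exp ((Complex.I * (θ : ℂ)) • pauliZ)

/-- The (single-qubit) QSP protocol of length `k` with real phases `Φ = (φ_0, …, φ_k)`, run on the oracle `U`:
`Φ[U] = e^{i φ_0 σ_z} (U e^{i φ_1 σ_z}) (U e^{i φ_2 σ_z}) ⋯ (U e^{i φ_k σ_z})`, the product being taken from left
to right. The length `k` is the number of calls to `U`. -/
noncomputable def qspProtocol {k : ℕ} (Φ : Fin (k + 1) → ℝ) (U : Matrix (Fin 2) (Fin 2) ℂ) :
    Matrix (Fin 2) (Fin 2) ℂ :=
  zRotation (Φ 0) * (List.ofFn fun j : Fin k => U * zRotation (Φ j.succ)).prod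

/-- The `σ_z`-QSP protocol `Φ'` belonging to the phases `Φ`: `Φ'[U] = H Φ[H U H] H`. -/
noncomputable def sigmaZQSPProtocol {k : ℕ} (Φ : Fin (k + 1) → ℝ) (U : Matrix (Fin 2) (Fin 2) ℂ) :
    Matrix (Fin 2) (Fin 2) ℂ :=
  hadamardGate * qspProtocol Φ (hadamardGate * U * hadamardGate) * hadamardGate

/-! ### Strict Fejér–Riesz factorization over the reals. -/

section FejerRiesz

open Polynomial

/-! Put z = e^{iφ}. If f and g are real polynomials of degree at most k with |f|² + |g|² = 1 on the
unit circle, some protocol of length k outputs the SU(2) matrix with first row (F, iG), where F =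
z⁻ᵏ f(z²) and G = z⁻ᵏ g(z²): `exists_phases` peels off one phase at a time, lowering the degree. Any
f with |f| < 1 on the circle has such a partner g by Fejér–Riesz
(`exists_complementary_polynomial`). It remains to approximate w^a, with w = e^{2iφ} and a =
1/2^{n+1}, away from w = -1, by a polynomial bounded by 1 on the whole circle, with degree uniform
in n.

The trigonometric polynomial F = `branchSum a m` solves F' = i(aF - sin^{2m}(θ/2)). The forcing is
tiny away from θ = ±π, so F(θ) ≈ F(0)e^{iaθ} (`norm_branchSum_sub_le`). A Sturm-type comparison
gives Im F ≥ 0 on [0, π], so |F| decreases there and is at most F(0) (`norm_branchSum_le`). Since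
F(0) ≥ 1/(m+1), normalizing costs only a factor m+1 against the decay (1-δ²)^m, and m of order δ⁻²
log(ε⁻²δ^{-1/2}) suffices. The matrix error is of the order of the square root of the error of its
first entry, so the latter is made at most ε²/3. -/

theorem aeval_reflect_of_norm_eq_one {k : ℕ} {f : ℝ[X]} (hf : f.natDegree ≤ k) {w : ℂ}
    (hw : ‖w‖ = 1) :
    aeval w (reflect k f) = w ^ k * starRingEnd ℂ (aeval w f) := by
  have hw0 : w ≠ 0 := by
    rintro rfl
    simp at hw
  have hinv : (starRingEnd ℂ w)⁻¹ = w := by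
    rw [← Complex.inv_eq_conj hw, inv_inv]
  have hc0 : starRingEnd ℂ w ≠ 0 := by simpa using hw0
  let _ : Invertible (starRingEnd ℂ w) := invertibleOfNonzero hc0
  have h := eval₂_reflect_mul_pow (algebraMap ℝ ℂ) (starRingEnd ℂ w) k f hf
  rw [invOf_eq_inv, hinv, ← aeval_def, ← aeval_def, aeval_conj] at h
  rw [← h, mul_comm (w ^ k), mul_assoc, ← mul_pow, mul_comm _ w, Complex.mul_conj]
  simp [Complex.normSq_eq_norm_sq, hw]

/-- The minimal polynomial divides (X - r)(X - r̄), so s is r or its conjugate. -/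
theorem norm_eq_of_aeval_minpoly_eq_zero {r s : ℂ} (h : aeval s (minpoly ℝ r) = 0) :
    ‖s‖ = ‖r‖ := by
  have hdvd : minpoly ℝ r ∣ X ^ 2 - C (2 * r.re) * X + C (‖r‖ ^ 2) :=
    minpoly.dvd ℝ r (by
      have h1 : (X ^ 2 - C (2 * r.re) * X + C (‖r‖ ^ 2) : ℝ[X]).map (algebraMap ℝ ℂ) =
          X ^ 2 - C ((2 * r.re : ℝ) : ℂ) * X + C (((‖r‖ ^ 2 : ℝ)) : ℂ) := by simp
      rw [aeval_def, ← eval_map, h1]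
      have h2 := Complex.mul_conj r
      have h3 := Complex.add_conj r
      rw [Complex.normSq_eq_norm_sq] at h2
      simp only [eval_add, eval_sub, eval_pow, eval_X, eval_mul, eval_C]
      rw [← h2, ← h3]
      ring)
  have h0 : aeval s (X ^ 2 - C (2 * r.re) * X + C (‖r‖ ^ 2) : ℝ[X]) = 0 :=
    aeval_eq_zero_of_dvd_aeval_eq_zero hdvd h
  have h1 : (X ^ 2 - C (2 * r.re) * X + C (‖r‖ ^ 2) : ℝ[X]).map (algebraMap ℝ ℂ) =
      X ^ 2 - C ((2 * r.re : ℝ) : ℂ) * X + C (((‖r‖ ^ 2 : ℝ)) : ℂ) := by simp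
  rw [aeval_def, ← eval_map, h1] at h0
  have h2 := Complex.mul_conj r
  have h3 := Complex.add_conj r
  rw [Complex.normSq_eq_norm_sq] at h2
  simp only [eval_add, eval_sub, eval_pow, eval_X, eval_mul, eval_C] at h0
  rw [← h2, ← h3] at h0
  have h4 : (s - r) * (s - starRingEnd ℂ r) = 0 := by linear_combination h0
  rcases mul_eq_zero.mp h4 with h5 | h5
  · rw [sub_eq_zero.mp h5]
  · rw [sub_eq_zero.mp h5, Complex.norm_conj]

/-- A polynomial which is strictly positive on the unit circle in the sense of Laurent
polynomials of order `k`, that is, `w⁻ᵏ h(w) > 0` for `‖w‖ = 1`. -/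
def CirclePositive (k : ℕ) (h : ℝ[X]) : Prop :=
  ∀ w : ℂ, ‖w‖ = 1 → ∃ r : ℝ, 0 < r ∧ aeval w h = r * w ^ k

/-- On the circle `p * reflect d p` equals w^d |p(w)|², so cancelling it lowers the order by d and
keeps positivity. -/
theorem CirclePositive.of_mul_reflect {d k : ℕ} {p h : ℝ[X]} (hp : p.natDegree ≤ d)
    (hh : CirclePositive (d + k) (p * reflect d p * h)) : CirclePositive k h := by
  intro w hw
  obtain ⟨r, hr, e⟩ := hh w hw
  have hw0 : w ≠ 0 := by
    rintro rfl
    simp at hw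
  rw [map_mul, map_mul, aeval_reflect_of_norm_eq_one hp hw, mul_left_comm,
    Complex.mul_conj, pow_add] at e
  have hn : Complex.normSq (aeval w p) ≠ 0 := by
    intro h0
    rw [h0] at e
    simp [hw0, hr.ne'] at e
  refine ⟨r / Complex.normSq (aeval w p),
    div_pos hr (lt_of_le_of_ne (Complex.normSq_nonneg _) hn.symm), ?_⟩
  have hn' : (Complex.normSq (aeval w p) : ℂ) ≠ 0 := by exact_mod_cast hn
  push_cast
  field_simp
  apply mul_left_cancel₀ (pow_ne_zero d hw0)
  linear_combination e

/-- Positivity keeps the roots of h off the circle. If the minimal polynomial p of a root r divided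
its reversal, 1/r would be a root of p too; the roots of p share one modulus, so |r| would be 1. -/
theorem CirclePositive.exists_isCoprime_factor {k : ℕ} {h : ℝ[X]} (hh : CirclePositive k h)
    (hd : 0 < h.natDegree) (h0 : h.coeff 0 ≠ 0) :
    ∃ p : ℝ[X], 0 < p.natDegree ∧ p.coeff 0 ≠ 0 ∧ p ∣ h ∧ IsCoprime p p.reverse := by
  have hd' : (h.map (algebraMap ℝ ℂ)).degree ≠ 0 := by
    rw [degree_map]
    exact (natDegree_pos_iff_degree_pos.mp hd).ne'
  obtain ⟨r, hr⟩ := IsAlgClosed.exists_root _ hd'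
  have hr' : aeval r h = 0 := by rwa [aeval_def, ← eval_map]
  have hint : IsIntegral ℝ r := Algebra.IsIntegral.isIntegral r
  have hr0 : r ≠ 0 := by
    rintro rfl
    apply h0
    have : aeval ((0 : ℝ) : ℂ) h = 0 := by simpa using hr'
    rw [coeff_zero_eq_eval_zero]
    have h2 := aeval_algebraMap_apply ℂ (0 : ℝ) h
    simp only [Complex.coe_algebraMap] at h2
    rw [this] at h2
    exact_mod_cast h2.symm
  have hr1 : ‖r‖ ≠ 1 := by
    intro h1
    obtain ⟨c, hc, e⟩ := hh r h1
    rw [hr'] at e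
    simp [hr0, hc.ne'] at e
  have hmin0 : (minpoly ℝ r).coeff 0 ≠ 0 := minpoly.coeff_zero_ne_zero hint hr0
  refine ⟨minpoly ℝ r, minpoly.natDegree_pos hint, hmin0, minpoly.dvd ℝ r hr', ?_⟩
  rw [(minpoly.irreducible hint).coprime_iff_not_dvd]
  intro hdvd
  have hroot : aeval r (minpoly ℝ r).reverse = 0 :=
    aeval_eq_zero_of_dvd_aeval_eq_zero hdvd (minpoly.aeval ℝ r)
  let _ : Invertible r⁻¹ := invertibleOfNonzero (inv_ne_zero hr0)
  have h2 := eval₂_reverse_eq_zero_iff (algebraMap ℝ ℂ) r⁻¹ (minpoly ℝ r)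
  rw [invOf_eq_inv, inv_inv, ← aeval_def, ← aeval_def] at h2
  have h3 := norm_eq_of_aeval_minpoly_eq_zero (h2.mp hroot)
  rw [norm_inv] at h3
  have hpos : 0 < ‖r‖ := norm_pos_iff.mpr hr0
  have h4 : ‖r‖ * ‖r‖ = 1 := by
    nth_rw 1 [← h3]
    exact inv_mul_cancel₀ hpos.ne'
  exact hr1 (by nlinarith)

/-- Strict real Fejér–Riesz theorem. -/
theorem CirclePositive.exists_eq_mul_reflect {k : ℕ} {h : ℝ[X]} (hh : CirclePositive k h)
    (hd : h.natDegree ≤ 2 * k) (hs : reflect (2 * k) h = h) :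
    ∃ g : ℝ[X], g.natDegree ≤ k ∧ h = g * reflect k g := by
  induction k using Nat.strong_induction_on generalizing h with
  | _ k ih =>
    have hcoeff : h.coeff (2 * k) = h.coeff 0 := by
      conv_lhs => rw [← hs]
      rw [coeff_reflect, revAt_le le_rfl, Nat.sub_self]
    have hne : h ≠ 0 := by
      rintro rfl
      obtain ⟨r, hr, e⟩ := hh 1 (by simp)
      simp at e
      exact hr.ne (by exact_mod_cast e)
    rcases Nat.eq_zero_or_pos k with rfl | hk
    · obtain ⟨c, rfl⟩ : ∃ c, h = C c := ⟨_, eq_C_of_natDegree_le_zero (by simpa using hd)⟩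
      obtain ⟨r, hr, e⟩ := hh 1 (by simp)
      have hc : c = r := by
        simp at e
        exact e
      refine ⟨C (Real.sqrt c), by simp, ?_⟩
      rw [reflect_C, pow_zero, mul_one, ← C_mul, Real.mul_self_sqrt (hc ▸ hr.le)]
    by_cases h0 : h.coeff 0 = 0
    -- By symmetry the top coefficient vanishes with the constant one, so dividing by X lowers k by
    -- one.
    · obtain ⟨h', rfl⟩ := X_dvd_iff.mpr h0
      have hne' : h' ≠ 0 := right_ne_zero_of_mul hne
      obtain ⟨j, rfl⟩ : ∃ j, k = j + 1 := ⟨k - 1, by omega⟩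
      have hd' : h'.natDegree ≤ 2 * j := by
        have h1 : (X * h').natDegree ≤ 2 * (j + 1) - 1 :=
          natDegree_le_pred hd (by rw [hcoeff, h0])
        rw [natDegree_X_mul hne'] at h1
        omega
      have hrefl : reflect (2 * j) h' = h' := by
        have h1 := reflect_mul (X : ℝ[X]) h' (F := 2) (G := 2 * j) (by simp) hd'
        rw [show 2 + 2 * j = 2 * (j + 1) by ring, hs] at h1
        have h2 : reflect 2 (X : ℝ[X]) = X := by
          simpa [revAt_le] using reflect_monomial 2 1 (R := ℝ)
        rw [h2] at h1
        exact (mul_left_cancel₀ X_ne_zero h1).symm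
      have hpos : CirclePositive j h' := by
        -- For p = 1 and d = 1 the product `p * reflect d p` is X.
        apply CirclePositive.of_mul_reflect (d := 1) (p := 1) (by simp)
        rw [reflect_one, pow_one, one_mul, add_comm]
        exact hh
      obtain ⟨g, hg, e⟩ := ih j (by omega) hpos hd' hrefl
      refine ⟨g, by omega, ?_⟩
      have h1 := reflect_mul (1 : ℝ[X]) g (F := 1) (G := j) (by simp) hg
      rw [one_mul, reflect_one, pow_one, add_comm] at h1
      rw [h1, e]
      ring
    · have hdeg : h.natDegree = 2 * k :=
        le_antisymm hd (le_natDegree_of_ne_zero (by rwa [hcoeff]))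
      obtain ⟨p, hp, hp0, hpdvd, hcop⟩ := hh.exists_isCoprime_factor (by omega) h0
      have hrev : h.reverse = h := by rw [reverse, hdeg, hs]
      have hpdvd' : p.reverse ∣ h := by
        obtain ⟨q, hq⟩ := hpdvd
        rw [← hrev, hq, reverse_mul_of_domain]
        exact dvd_mul_right _ _
      obtain ⟨h', e⟩ := hcop.mul_dvd hpdvd hpdvd'
      have hpr : p.reverse.natDegree = p.natDegree := by
        rw [reverse_natDegree, natTrailingDegree_eq_zero.mpr (Or.inr hp0), Nat.sub_zero]
      have hpp : p * p.reverse ≠ 0 := fun h1 => hne (by rw [e, h1, zero_mul])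
      have hne' : h' ≠ 0 := fun h1 => hne (by rw [e, h1, mul_zero])
      have hdeg' : p.natDegree + p.natDegree + h'.natDegree = 2 * k := by
        rw [← hdeg, e, natDegree_mul hpp hne',
          natDegree_mul (left_ne_zero_of_mul hpp) (right_ne_zero_of_mul hpp), hpr]
      obtain ⟨j, hj⟩ : ∃ j, k = p.natDegree + j := ⟨k - p.natDegree, by omega⟩
      have hd' : h'.natDegree = 2 * j := by omega
      have hrefl : reflect (2 * j) h' = h' := by
        have h1 : h.reverse = p.reverse * p * h'.reverse := by
          rw [e, reverse_mul_of_domain, reverse_mul_of_domain]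
          congr 2
          rw [reverse, hpr, reverse, reflect_reflect]
        rw [hrev, e, mul_comm p.reverse] at h1
        rw [← hd']
        exact (mul_left_cancel₀ hpp h1).symm
      have hpos : CirclePositive j h' := by
        apply CirclePositive.of_mul_reflect (d := p.natDegree) (p := p) le_rfl
        rw [← hj]
        change CirclePositive k (p * p.reverse * h')
        rwa [← e]
      obtain ⟨g, hg, e'⟩ := ih j (by omega) hpos hd'.le hrefl
      refine ⟨p * g, natDegree_mul_le.trans (by omega), ?_⟩
      rw [hj, reflect_mul p g le_rfl hg, e, e', reverse]
      ring

/-- A real polynomial of norm less than one on the unit circle has a complementary polynomial. -/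
theorem exists_complementary_polynomial {k : ℕ} {f : ℝ[X]} (hf : f.natDegree ≤ k)
    (hlt : ∀ w : ℂ, ‖w‖ = 1 → ‖aeval w f‖ < 1) :
    ∃ g : ℝ[X], g.natDegree ≤ k ∧ f * reflect k f + g * reflect k g = X ^ k := by
  have hr : (reflect k f).natDegree ≤ k := natDegree_reflect_le.trans (by simp [hf])
  -- On the circle this polynomial is w^k (1 - |f(w)|²).
  have hpos : CirclePositive k (X ^ k - f * reflect k f) := by
    intro w hw
    refine ⟨1 - ‖aeval w f‖ ^ 2, ?_, ?_⟩
    · have := hlt w hw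
      nlinarith [norm_nonneg (aeval w f)]
    · rw [map_sub, map_mul, aeval_reflect_of_norm_eq_one hf hw, mul_left_comm, Complex.mul_conj,
        Complex.normSq_eq_norm_sq]
      simp
      ring
  obtain ⟨g, hg, e⟩ := hpos.exists_eq_mul_reflect
    ((natDegree_sub_le _ _).trans (max_le (by simp; omega)
      (natDegree_mul_le.trans (by omega)))) (by
      rw [reflect_sub, reflect_monomial, revAt_le (by omega), two_mul, Nat.add_sub_cancel,
        reflect_mul f _ hf hr, reflect_reflect, mul_comm f])
  exact ⟨g, hg, by rw [← e]; ring⟩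

end FejerRiesz

/-! ### From complementary polynomials to phases. -/

section Realization

open Polynomial

theorem zRotation_eq (θ : ℝ) :
    zRotation θ = !![Complex.exp (Complex.I * θ), 0; 0, Complex.exp (-(Complex.I * θ))] := by
  have h : (Complex.I * (θ : ℂ)) • pauliZ =
      Matrix.diagonal ![Complex.I * θ, -(Complex.I * θ)] := by
    ext i j
    fin_cases i <;> fin_cases j <;> simp [pauliZ]
  rw [zRotation, h, Matrix.exp_diagonal]
  ext i j
  fin_cases i <;> fin_cases j <;> simp [Complex.exp_eq_exp_ℂ, Pi.coe_exp]

theorem hadamardGate_conj_zRotation (θ : ℝ) :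
    hadamardGate * zRotation θ * hadamardGate =
      !![Complex.cos θ, Complex.I * Complex.sin θ; Complex.I * Complex.sin θ, Complex.cos θ] := by
  have h : (((1 / Real.sqrt 2 : ℝ) : ℂ)) * ((1 / Real.sqrt 2 : ℝ) : ℂ) = 1 / 2 := by
    rw [← Complex.ofReal_mul, div_mul_div_comm, Real.mul_self_sqrt (by norm_num)]
    norm_num
  rw [hadamardGate, zRotation_eq, Matrix.smul_mul, Matrix.mul_smul, Matrix.smul_mul, smul_smul, h]
  have e1 : Complex.exp (Complex.I * θ) = Complex.cos θ + Complex.sin θ * Complex.I := by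
    rw [mul_comm, Complex.exp_mul_I]
  have e2 : Complex.exp (-(Complex.I * θ)) = Complex.cos θ - Complex.sin θ * Complex.I := by
    rw [mul_comm, ← neg_mul, Complex.exp_mul_I, Complex.cos_neg, Complex.sin_neg]
    ring
  rw [e1, e2]
  ext i j
  fin_cases i <;> fin_cases j <;>
    simp <;> ring

theorem sigmaZQSPProtocol_snoc {k : ℕ} (Φ : Fin (k + 1) → ℝ) (x : ℝ)
    (U : Matrix (Fin 2) (Fin 2) ℂ) :
    sigmaZQSPProtocol (Fin.snoc Φ x : Fin (k + 1 + 1) → ℝ) U =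
      sigmaZQSPProtocol Φ U * (U * (hadamardGate * zRotation x * hadamardGate)) := by
  have h : qspProtocol (Fin.snoc Φ x : Fin (k + 1 + 1) → ℝ) (hadamardGate * U * hadamardGate) =
      qspProtocol Φ (hadamardGate * U * hadamardGate) *
        (hadamardGate * U * hadamardGate * zRotation x) := by
    rw [qspProtocol, List.ofFn_succ', List.concat_eq_append, List.prod_append, List.prod_singleton,
      ← mul_assoc, qspProtocol]
    have h1 : (Fin.snoc Φ x : Fin (k + 1 + 1) → ℝ) (Fin.last k).succ = x := by
      rw [Fin.succ_last, Fin.snoc_last]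
    have h2 : ∀ j : Fin k, (Fin.snoc Φ x : Fin (k + 1 + 1) → ℝ) j.castSucc.succ = Φ j.succ :=
      fun j => by rw [Fin.succ_castSucc, Fin.snoc_castSucc]
    have h3 : (Fin.snoc Φ x : Fin (k + 1 + 1) → ℝ) 0 = Φ 0 := by
      rw [← Fin.castSucc_zero, Fin.snoc_castSucc]
    simp only [h1, h2, h3]
  rw [sigmaZQSPProtocol, h, sigmaZQSPProtocol]
  simp only [mul_assoc]

/-- The value at `z = e^{iφ}` of the Laurent polynomial `z⁻ᵏ f(z²)`. -/
noncomputable def laurentEval (k : ℕ) (f : ℝ[X]) (φ : ℝ) : ℂ :=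
  Complex.exp (Complex.I * φ) ^ (-(k : ℤ)) * aeval (Complex.exp (Complex.I * φ) ^ 2) f

/-- The quaternionic matrix with first row `(F, iG)`. -/
noncomputable def quaternionMatrix (F G : ℂ) : Matrix (Fin 2) (Fin 2) ℂ :=
  !![F, Complex.I * G; Complex.I * starRingEnd ℂ G, starRingEnd ℂ F]

/-- One more call rotates the pair (zF, z⁻¹G) by the real angle x; inverting this rotation gives the
degree reduction in `exists_phases`. -/
theorem quaternionMatrix_mul_rotation (F G : ℂ) (φ x : ℝ) :
    quaternionMatrix F G * (zRotation φ * (hadamardGate * zRotation x * hadamardGate)) =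
      quaternionMatrix
        (Real.cos x * (Complex.exp (Complex.I * φ) * F) -
          Real.sin x * ((Complex.exp (Complex.I * φ))⁻¹ * G))
        (Real.sin x * (Complex.exp (Complex.I * φ) * F) +
          Real.cos x * ((Complex.exp (Complex.I * φ))⁻¹ * G)) := by
  have hc : starRingEnd ℂ (Complex.exp (Complex.I * φ)) = (Complex.exp (Complex.I * φ))⁻¹ := by
    rw [← Complex.exp_conj, ← Complex.exp_neg]
    simp
  rw [hadamardGate_conj_zRotation, zRotation_eq, quaternionMatrix, quaternionMatrix,
    Complex.exp_neg]
  simp only [map_add, map_sub, map_mul, map_inv₀, hc, inv_inv, Complex.conj_ofReal]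
  push_cast
  have hI : Complex.I ^ 2 = -1 := Complex.I_sq
  ext i j
  fin_cases i <;> fin_cases j <;>
    simp [Matrix.mul_apply, Fin.sum_univ_two] <;> ring_nf <;> simp only [hI] <;> ring

theorem exists_rotation_cancel {a b a' b' : ℝ} (h : a * a' + b * b' = 0) :
    ∃ x : ℝ, Real.cos x * a' + Real.sin x * b' = 0 ∧ Real.cos x * b - Real.sin x * a = 0 := by
  have key : ∀ c d : ℝ, ∃ x r : ℝ, c = r * Real.cos x ∧ d = r * Real.sin x := fun c d =>
    ⟨Complex.arg ⟨c, d⟩, ‖(⟨c, d⟩ : ℂ)‖, by rw [Complex.norm_mul_cos_arg],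
      by rw [Complex.norm_mul_sin_arg]⟩
  obtain ⟨x, r, ha, hb⟩ := key a b
  -- The angle is the argument of (a, b). When (a, b) = 0 the second equation is empty and the angle
  -- is chosen from (a', b') alone.
  by_cases hr : r = 0
  · subst hr
    obtain ⟨y, s, hb', ha'⟩ := key b' (-a')
    refine ⟨y, ?_, ?_⟩
    · rw [hb', ← neg_neg a', ha']
      ring
    · simp [ha, hb]
  · refine ⟨x, ?_, by rw [ha, hb]; ring⟩
    apply mul_left_cancel₀ hr
    rw [ha, hb] at h
    linear_combination h

/-- Complementary real polynomials are realized by a QSP protocol. -/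
theorem exists_phases {k : ℕ} {f g : ℝ[X]} (hf : f.natDegree ≤ k) (hg : g.natDegree ≤ k)
    (h : f * reflect k f + g * reflect k g = X ^ k) :
    ∃ Φ : Fin (k + 1) → ℝ, ∀ φ : ℝ, sigmaZQSPProtocol Φ (zRotation φ) =
      quaternionMatrix (laurentEval k f φ) (laurentEval k g φ) := by
  induction k generalizing f g with
  | zero =>
    obtain ⟨a, rfl⟩ : ∃ a, f = C a := ⟨_, eq_C_of_natDegree_le_zero hf⟩
    obtain ⟨b, rfl⟩ : ∃ b, g = C b := ⟨_, eq_C_of_natDegree_le_zero hg⟩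
    have hab : a * a + b * b = 1 := by
      rw [reflect_C, reflect_C] at h
      simpa using congrArg (eval 0) h
    have hn : ‖(⟨a, b⟩ : ℂ)‖ = 1 := by
      rw [Complex.norm_def, Complex.normSq_mk, hab, Real.sqrt_one]
    have ha := Complex.norm_mul_cos_arg (⟨a, b⟩ : ℂ)
    have hb := Complex.norm_mul_sin_arg (⟨a, b⟩ : ℂ)
    rw [hn, one_mul] at ha hb
    refine ⟨fun _ => Complex.arg ⟨a, b⟩, fun φ => ?_⟩
    rw [sigmaZQSPProtocol, qspProtocol, List.ofFn_zero, List.prod_nil, mul_one,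
      hadamardGate_conj_zRotation, ← Complex.ofReal_cos, ← Complex.ofReal_sin, ha, hb]
    simp [quaternionMatrix, laurentEval]
  | succ k ih =>
    -- The constant term of the identity makes the top and bottom coefficient vectors of (f, g)
    -- orthogonal, so a single rotation removes the constant term of one combination and the top
    -- term of the other.
    have h0 : f.coeff (k + 1) * f.coeff 0 + g.coeff (k + 1) * g.coeff 0 = 0 := by
      have h1 := congrArg (fun p => coeff p 0) h
      simp only [coeff_add, mul_coeff_zero, coeff_reflect, revAt_zero, coeff_X_pow] at h1
      rw [if_neg (by omega)] at h1
      linear_combination h1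
    obtain ⟨x, hx1, hx2⟩ := exists_rotation_cancel h0
    obtain ⟨f', hf'⟩ : X ∣ C (Real.cos x) * f + C (Real.sin x) * g :=
      X_dvd_iff.mpr (by simpa using hx1)
    set g' := C (Real.cos x) * g - C (Real.sin x) * f with hg'
    have hcs : (C (Real.cos x) * C (Real.cos x) + C (Real.sin x) * C (Real.sin x) : ℝ[X]) = 1 := by
      rw [← C_mul, ← C_mul, ← C_add, ← C_1]
      congr 1
      nlinarith [Real.sin_sq_add_cos_sq x]
    have ef : f = C (Real.cos x) * (X * f') - C (Real.sin x) * g' := by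
      rw [← hf', hg']
      linear_combination -f * hcs
    have eg : g = C (Real.sin x) * (X * f') + C (Real.cos x) * g' := by
      rw [← hf', hg']
      linear_combination -g * hcs
    have hdf : f'.natDegree ≤ k := by
      rcases eq_or_ne f' 0 with rfl | hne
      · simp
      have h1 : (X * f').natDegree ≤ k + 1 := by
        rw [← hf']
        exact natDegree_add_le_of_degree_le ((natDegree_C_mul_le _ _).trans hf)
          ((natDegree_C_mul_le _ _).trans hg)
      rw [natDegree_X_mul hne] at h1
      omega
    have hdg : g'.natDegree ≤ k := by
      have h1 : g'.natDegree ≤ k + 1 :=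
        (natDegree_sub_le _ _).trans (max_le ((natDegree_C_mul_le _ _).trans hg)
          ((natDegree_C_mul_le _ _).trans hf))
      exact natDegree_le_pred h1 (by simpa [hg'] using hx2)
    have rf : reflect (k + 1) (X * f') = reflect k f' := by
      rw [add_comm, reflect_mul X f' (by simp) hdf, reflect_one_X, one_mul]
    have rg : reflect (k + 1) g' = X * reflect k g' := by
      have h1 := reflect_mul (1 : ℝ[X]) g' (F := 1) (G := k) (by simp) hdg
      rwa [one_mul, reflect_one, pow_one, add_comm] at h1
    have hrec : f' * reflect k f' + g' * reflect k g' = X ^ k := by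
      rw [ef, eg] at h
      simp only [reflect_add, reflect_sub, reflect_C_mul, rf, rg] at h
      apply mul_left_cancel₀ (X_ne_zero (R := ℝ))
      rw [← pow_succ', ← h]
      linear_combination
        -(X * (f' * reflect k f' + g' * reflect k g')) * hcs
    obtain ⟨Φ, hΦ⟩ := ih hdf hdg hrec
    refine ⟨Fin.snoc Φ x, fun φ => ?_⟩
    rw [sigmaZQSPProtocol_snoc, hΦ, quaternionMatrix_mul_rotation]
    have hz : Complex.exp (Complex.I * φ) ≠ 0 := Complex.exp_ne_zero _
    have hpow : Complex.exp (Complex.I * φ) ^ (-((k + 1 : ℕ) : ℤ)) =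
        Complex.exp (Complex.I * φ) ^ (-(k : ℤ)) * (Complex.exp (Complex.I * φ))⁻¹ := by
      rw [← zpow_neg_one, ← zpow_add₀ hz]
      congr 1
      push_cast
      ring
    congr 1
    · rw [ef, laurentEval, laurentEval, laurentEval, hpow]
      simp only [map_sub, map_mul, aeval_X, aeval_C, Complex.coe_algebraMap]
      field_simp
    · rw [eg, laurentEval, laurentEval, laurentEval, hpow]
      simp only [map_add, map_mul, aeval_X, aeval_C, Complex.coe_algebraMap]
      field_simp

end Realization

/-! ### A trigonometric polynomial close to a multiple of e^{iaθ}. -/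

section BranchApproximation

open Polynomial

/-- Here Y'' + a²Y = -S' ≤ 0 with zero boundary values, and a < 1 makes v = cos(a(t - π/2)) a
positive solution of the homogeneous equation on [0, π]. -/
theorem nonneg_of_forced_oscillator {a : ℝ} (ha : 0 < a) (ha' : a ≤ 1 / 2) {X Y S S' : ℝ → ℝ}
    (hX : ∀ t, HasDerivAt X (-(a * Y t)) t) (hY : ∀ t, HasDerivAt Y (a * X t - S t) t)
    (hS : ∀ t, HasDerivAt S (S' t) t) (hS' : ∀ t ∈ Set.Icc 0 Real.pi, 0 ≤ S' t)
    (h0 : Y 0 = 0) (hpi : Y Real.pi = 0) {t : ℝ} (ht : t ∈ Set.Icc 0 Real.pi) : 0 ≤ Y t := by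
  have hlin : ∀ t, HasDerivAt (fun t => a * (t - Real.pi / 2)) a t := fun t => by
    simpa using ((hasDerivAt_id t).sub_const (Real.pi / 2)).const_mul a
  have hv : ∀ t ∈ Set.Icc 0 Real.pi, 0 < Real.cos (a * (t - Real.pi / 2)) := by
    intro t ht
    apply Real.cos_pos_of_mem_Ioo
    constructor <;> nlinarith [ht.1, ht.2, Real.pi_pos]
  -- The Wronskian vY' - v'Y, so that (Y/v)' = h/v² and h' = -vS'.
  set h : ℝ → ℝ := fun t => Real.cos (a * (t - Real.pi / 2)) * (a * X t - S t) +
    a * Real.sin (a * (t - Real.pi / 2)) * Y t with hh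
  have hhd : ∀ t, HasDerivAt h (-(Real.cos (a * (t - Real.pi / 2)) * S' t)) t := by
    intro t
    have h1 := ((hlin t).cos.mul (((hX t).const_mul a).sub (hS t))).add
      (((hlin t).sin.const_mul a).mul (hY t))
    refine h1.congr_deriv ?_
    simp only [Pi.sub_apply]
    ring
  have hanti : AntitoneOn h (Set.Icc 0 Real.pi) := by
    apply antitoneOn_of_deriv_nonpos (convex_Icc _ _)
    · exact fun t _ => (hhd t).continuousAt.continuousWithinAt
    · exact fun t _ => (hhd t).differentiableAt.differentiableWithinAt
    · intro t ht
      rw [(hhd t).deriv]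
      have ht' := interior_subset ht
      exact neg_nonpos.mpr (mul_nonneg (hv t ht').le (hS' t ht'))
  have hq : ∀ t ∈ Set.Icc 0 Real.pi, HasDerivAt
      (fun t => Y t / Real.cos (a * (t - Real.pi / 2)))
      (h t / Real.cos (a * (t - Real.pi / 2)) ^ 2) t := by
    intro t ht
    refine ((hY t).div (hlin t).cos (hv t ht).ne').congr_deriv ?_
    rw [hh]
    congr 1
    ring
  -- A negative value of Y/v forces a negative slope before t and a positive one after, whereas h is
  -- decreasing.
  by_contra! hneg
  have ht0 : 0 < t := lt_of_le_of_ne ht.1 (by rintro rfl; exact hneg.ne h0)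
  have ht1 : t < Real.pi := lt_of_le_of_ne ht.2 (by rintro rfl; exact hneg.ne hpi)
  have hqneg : Y t / Real.cos (a * (t - Real.pi / 2)) < 0 := div_neg_of_neg_of_pos hneg (hv t ht)
  obtain ⟨c, hc, ec⟩ := exists_hasDerivAt_eq_slope
    (fun t => Y t / Real.cos (a * (t - Real.pi / 2))) _ ht0
    (fun s hs => (hq s ⟨hs.1, hs.2.trans ht.2⟩).continuousAt.continuousWithinAt)
    (fun s hs => hq s ⟨hs.1.le, hs.2.le.trans ht.2⟩)
  obtain ⟨d, hd, ed⟩ := exists_hasDerivAt_eq_slope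
    (fun t => Y t / Real.cos (a * (t - Real.pi / 2))) _ ht1
    (fun s hs => (hq s ⟨ht.1.trans hs.1, hs.2⟩).continuousAt.continuousWithinAt)
    (fun s hs => hq s ⟨ht.1.trans hs.1.le, hs.2.le⟩)
  simp only [h0, hpi, zero_div, sub_zero, zero_sub] at ec ed
  have hc' : c ∈ Set.Icc 0 Real.pi := ⟨hc.1.le, hc.2.le.trans ht.2⟩
  have hd' : d ∈ Set.Icc 0 Real.pi := ⟨ht.1.trans hd.1.le, hd.2.le⟩
  have hcneg : h c < 0 := by
    have h1 : h c / Real.cos (a * (c - Real.pi / 2)) ^ 2 < 0 := by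
      rw [ec]
      exact div_neg_of_neg_of_pos hqneg ht0
    by_contra! h2
    exact absurd (div_nonneg h2 (sq_nonneg _)) (not_le.mpr h1)
  have hdpos : 0 < h d := by
    have h1 : 0 < h d / Real.cos (a * (d - Real.pi / 2)) ^ 2 := by
      rw [ed]
      exact div_pos (neg_pos.mpr hqneg) (sub_pos.mpr ht1)
    by_contra! h2
    exact absurd (div_nonpos_of_nonpos_of_nonneg h2 (sq_nonneg _)) (not_le.mpr h1)
  linarith [hanti hc' hd' (hc.2.le.trans hd.1.le)]

/-- The coefficients of the polynomial approximating `w ^ (m + a)` on the unit circle. -/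
noncomputable def branchCoeff (a : ℝ) (m l : ℕ) : ℝ :=
  (-1) ^ (l + m) * (2 * m).choose l / 4 ^ m / (a - (l - m))

/-- The trigonometric polynomial `F` of degree `m` with `F' = i (a F - sin (θ / 2) ^ (2 m))`. -/
noncomputable def branchSum (a : ℝ) (m : ℕ) (θ : ℝ) : ℂ :=
  ∑ l ∈ Finset.range (2 * m + 1),
    (branchCoeff a m l : ℂ) * Complex.exp (Complex.I * (((l : ℝ) - m : ℝ)) * θ)

/-- Binomial expansion of (1 - e^{iθ})^{2m}, using (1 - e^{iθ})² = -4e^{iθ} sin²(θ/2). -/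
theorem sum_choose_exp_eq_sin_pow (m : ℕ) (θ : ℝ) :
    ∑ l ∈ Finset.range (2 * m + 1), (((-1) ^ (l + m) * (2 * m).choose l / 4 ^ m : ℝ) : ℂ) *
      Complex.exp (Complex.I * (((l : ℝ) - m : ℝ)) * θ) = ((Real.sin (θ / 2) ^ (2 * m) : ℝ) : ℂ) := by
  set e := Complex.exp (Complex.I * θ) with he
  have he0 : e ≠ 0 := Complex.exp_ne_zero _
  have hsq : (-e + 1) ^ 2 = -4 * e * (Complex.sin (θ / 2)) ^ 2 := by
    have h1 : Complex.cos θ = 1 - 2 * Complex.sin (θ / 2) ^ 2 := by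
      have h2 := Complex.cos_two_mul (θ / 2 : ℂ)
      rw [mul_div_cancel₀ _ two_ne_zero] at h2
      rw [h2, Complex.cos_sq']
      ring
    have h3 : e + e⁻¹ = 2 * Complex.cos θ := by
      rw [he, ← Complex.exp_neg, Complex.two_cos]
      congr 2 <;> ring
    have h4 : e ^ 2 + 1 = 2 * Complex.cos θ * e := by
      rw [← h3]
      field_simp
    rw [h1] at h4
    linear_combination h4
  have hexp : ∀ l : ℕ, Complex.exp (Complex.I * (((l : ℝ) - m : ℝ)) * θ) = e ^ l * (e ^ m)⁻¹ := by
    intro l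
    rw [he, ← Complex.exp_nat_mul, ← Complex.exp_nat_mul, ← Complex.exp_neg, ← Complex.exp_add]
    congr 1
    push_cast
    ring
  have hsum := add_pow (-e) 1 (2 * m)
  rw [pow_mul, hsq] at hsum
  have h4 : (4 : ℂ) ^ m ≠ 0 := pow_ne_zero _ (by norm_num)
  have hrhs : ((Real.sin (θ / 2) ^ (2 * m) : ℝ) : ℂ) =
      (-1) ^ m / 4 ^ m * (e ^ m)⁻¹ * (-4 * e * (Complex.sin (θ / 2)) ^ 2) ^ m := by
    have h5 : ((-1 : ℂ)) ^ m * (-1) ^ m = 1 := by rw [← mul_pow]; norm_num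
    rw [mul_pow, mul_pow, neg_pow (4 : ℂ)]
    push_cast
    rw [pow_mul]
    field_simp
    linear_combination -h5 * (Complex.sin (θ / 2) ^ 2) ^ m
  rw [hrhs, hsum, Finset.mul_sum]
  refine Finset.sum_congr rfl fun l _ => ?_
  rw [hexp, neg_pow e, pow_add]
  push_cast
  ring

theorem branch_denominator_ne_zero {a : ℝ} (ha : 0 < a) (ha' : a ≤ 1 / 2) (l m : ℕ) :
    a - ((l : ℝ) - m) ≠ 0 := by
  intro h
  have h1 : a = (((l : ℤ) - (m : ℤ) : ℤ) : ℝ) := by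
    push_cast
    linarith
  rw [h1] at ha ha'
  have h2 : (0 : ℤ) < (l : ℤ) - m := by exact_mod_cast ha
  have h3 : (1 : ℝ) ≤ (((l : ℤ) - (m : ℤ) : ℤ) : ℝ) := by exact_mod_cast h2
  linarith

theorem hasDerivAt_branchSum {a : ℝ} (ha : 0 < a) (ha' : a ≤ 1 / 2) (m : ℕ) (θ : ℝ) :
    HasDerivAt (branchSum a m)
      (Complex.I * (a * branchSum a m θ - (Real.sin (θ / 2) ^ (2 * m) : ℝ))) θ := by
  have h1 : ∀ l ∈ Finset.range (2 * m + 1), HasDerivAt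
      (fun t : ℝ => (branchCoeff a m l : ℂ) * Complex.exp (Complex.I * (((l : ℝ) - m : ℝ)) * t))
      ((branchCoeff a m l : ℂ) * (Complex.exp (Complex.I * (((l : ℝ) - m : ℝ)) * θ) *
        (Complex.I * (((l : ℝ) - m : ℝ))))) θ := by
    intro l _
    have h2 : HasDerivAt (fun t : ℝ => Complex.I * (((l : ℝ) - m : ℝ)) * (t : ℂ))
        (Complex.I * (((l : ℝ) - m : ℝ))) θ := by
      simpa using (Complex.ofRealCLM.hasDerivAt (x := θ)).const_mul
        (Complex.I * (((l : ℝ) - m : ℝ) : ℂ))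
    exact h2.cexp.const_mul _
  have h3 := HasDerivAt.fun_sum h1
  refine h3.congr_deriv ?_
  symm
  rw [← sum_choose_exp_eq_sin_pow, branchSum, Finset.mul_sum, ← Finset.sum_sub_distrib,
    Finset.mul_sum]
  refine Finset.sum_congr rfl fun l _ => ?_
  have h4 : ((-1) ^ (l + m) * (2 * m).choose l / 4 ^ m : ℝ) =
      branchCoeff a m l * (a - (l - m)) := by
    rw [branchCoeff, div_mul_cancel₀ _ (branch_denominator_ne_zero ha ha' l m)]
  rw [h4]
  push_cast
  ring

theorem branchSum_neg (a : ℝ) (m : ℕ) (θ : ℝ) :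
    branchSum a m (-θ) = starRingEnd ℂ (branchSum a m θ) := by
  rw [branchSum, branchSum, map_sum]
  refine Finset.sum_congr rfl fun l _ => ?_
  rw [map_mul, Complex.conj_ofReal, ← Complex.exp_conj]
  simp

theorem branchSum_pi_im (a : ℝ) (m : ℕ) : (branchSum a m Real.pi).im = 0 := by
  rw [branchSum, Complex.im_sum]
  refine Finset.sum_eq_zero fun l _ => ?_
  rw [Complex.im_ofReal_mul, mul_eq_zero]
  right
  have h : Complex.I * (((l : ℝ) - m : ℝ)) * (Real.pi : ℂ) =
      ((((l : ℤ) - (m : ℤ) : ℤ) * Real.pi : ℝ) : ℂ) * Complex.I := by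
    push_cast
    ring
  rw [h, Complex.exp_ofReal_mul_I_im, Real.sin_int_mul_pi]

theorem branchSum_zero_im (a : ℝ) (m : ℕ) : (branchSum a m 0).im = 0 := by
  rw [branchSum, Complex.im_sum]
  exact Finset.sum_eq_zero fun l _ => by simp

theorem hasDerivAt_branchSum_re {a : ℝ} (ha : 0 < a) (ha' : a ≤ 1 / 2) (m : ℕ) (θ : ℝ) :
    HasDerivAt (fun t => (branchSum a m t).re) (-(a * (branchSum a m θ).im)) θ := by
  have h := Complex.reCLM.hasFDerivAt.comp_hasDerivAt θ (hasDerivAt_branchSum ha ha' m θ)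
  refine h.congr_deriv ?_
  simp [-Complex.ofReal_pow, -Complex.ofReal_sin]

theorem hasDerivAt_branchSum_im {a : ℝ} (ha : 0 < a) (ha' : a ≤ 1 / 2) (m : ℕ) (θ : ℝ) :
    HasDerivAt (fun t => (branchSum a m t).im)
      (a * (branchSum a m θ).re - Real.sin (θ / 2) ^ (2 * m)) θ := by
  have h := Complex.imCLM.hasFDerivAt.comp_hasDerivAt θ (hasDerivAt_branchSum ha ha' m θ)
  refine h.congr_deriv ?_
  simp [-Complex.ofReal_pow, -Complex.ofReal_sin]

theorem hasDerivAt_sin_half_pow (n : ℕ) (θ : ℝ) :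
    HasDerivAt (fun t => Real.sin (t / 2) ^ n)
      (n * Real.sin (θ / 2) ^ (n - 1) * (Real.cos (θ / 2) * (1 / 2))) θ :=
  (((hasDerivAt_id θ).div_const 2).sin).pow n

theorem sin_half_nonneg {θ : ℝ} (hθ : θ ∈ Set.Icc 0 Real.pi) : 0 ≤ Real.sin (θ / 2) :=
  Real.sin_nonneg_of_nonneg_of_le_pi (by linarith [hθ.1]) (by linarith [hθ.1, hθ.2])

theorem cos_half_nonneg {θ : ℝ} (hθ : θ ∈ Set.Icc 0 Real.pi) : 0 ≤ Real.cos (θ / 2) :=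
  Real.cos_nonneg_of_mem_Icc ⟨by linarith [hθ.1, Real.pi_pos], by linarith [hθ.2]⟩

theorem branchSum_im_nonneg {a : ℝ} (ha : 0 < a) (ha' : a ≤ 1 / 2) (m : ℕ) {θ : ℝ}
    (hθ : θ ∈ Set.Icc 0 Real.pi) : 0 ≤ (branchSum a m θ).im :=
  nonneg_of_forced_oscillator ha ha' (hasDerivAt_branchSum_re ha ha' m)
    (hasDerivAt_branchSum_im ha ha' m) (hasDerivAt_sin_half_pow (2 * m))
    (fun t ht => by
      have := sin_half_nonneg ht
      have := cos_half_nonneg ht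
      positivity)
    (branchSum_zero_im a m) (branchSum_pi_im a m) hθ

/-- Im(F e^{ia(π-t)}) has derivative -sin^{2m}(t/2) cos(a(π-t)), so F(0) sin(aπ) is the integral of
sin^{2m}(t/2) cos(a(π-t)) over [0, π]. The cosine is at least sin(t/2) cos(t/2), and the resulting
integral is exactly 1/(m+1). -/
theorem one_div_le_branchSum_zero_re {a : ℝ} (ha : 0 < a) (ha' : a ≤ 1 / 2) (m : ℕ) :
    1 / ((m : ℝ) + 1) ≤ (branchSum a m 0).re := by
  have hlin : ∀ t, HasDerivAt (fun t => a * (Real.pi - t)) (-a) t := fun t => by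
    simpa using ((hasDerivAt_id t).const_sub Real.pi).const_mul a
  have hd : ∀ t, HasDerivAt (fun t => (branchSum a m t).re * Real.sin (a * (Real.pi - t)) +
      (branchSum a m t).im * Real.cos (a * (Real.pi - t)) +
      Real.sin (t / 2) ^ (2 * m + 2) / (m + 1))
      (-(Real.sin (t / 2) ^ (2 * m) * Real.cos (a * (Real.pi - t))) +
        Real.sin (t / 2) ^ (2 * m) * (Real.sin (t / 2) * Real.cos (t / 2))) t := by
    intro t
    have h := (((hasDerivAt_branchSum_re ha ha' m t).mul (hlin t).sin).add
      ((hasDerivAt_branchSum_im ha ha' m t).mul (hlin t).cos)).add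
      ((hasDerivAt_sin_half_pow (2 * m + 2) t).div_const ((m : ℝ) + 1))
    refine h.congr_deriv ?_
    have hm : (m : ℝ) + 1 ≠ 0 := by positivity
    rw [show 2 * m + 2 - 1 = 2 * m + 1 by omega]
    push_cast
    field_simp
    ring
  have hanti := antitoneOn_of_deriv_nonpos (convex_Icc 0 Real.pi)
    (fun t _ => (hd t).continuousAt.continuousWithinAt)
    (fun t _ => (hd t).differentiableAt.differentiableWithinAt)
    (fun t ht => by
      have ht' := interior_subset ht
      rw [(hd t).deriv]
      have hs := sin_half_nonneg ht'
      have hcos : Real.sin (t / 2) ≤ Real.cos (a * (Real.pi - t)) := by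
        rw [← Real.cos_pi_div_two_sub]
        apply Real.cos_le_cos_of_nonneg_of_le_pi
        · nlinarith [ht'.2]
        · nlinarith [ht'.1, Real.pi_pos]
        · nlinarith [ht'.1, ht'.2]
      have h1 : Real.sin (t / 2) * Real.cos (t / 2) ≤ Real.cos (a * (Real.pi - t)) :=
        (mul_le_of_le_one_right hs (Real.cos_le_one _)).trans hcos
      have h2 : 0 ≤ Real.sin (t / 2) ^ (2 * m) := pow_nonneg hs _
      nlinarith [mul_le_mul_of_nonneg_left h1 h2])
  have h := hanti (Set.left_mem_Icc.mpr Real.pi_pos.le) (Set.right_mem_Icc.mpr Real.pi_pos.le)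
    Real.pi_pos.le
  simp [branchSum_pi_im, branchSum_zero_im] at h
  rw [one_div]
  have hm : 0 < ((m : ℝ) + 1)⁻¹ := by positivity
  have hs : 0 < Real.sin (a * Real.pi) :=
    Real.sin_pos_of_pos_of_lt_pi (by positivity) (by nlinarith [Real.pi_pos])
  have hpos : 0 < (branchSum a m 0).re := by
    by_contra! hneg
    nlinarith [mul_nonneg (neg_nonneg.mpr hneg) hs.le]
  exact h.trans (mul_le_of_le_one_right hpos.le (Real.sin_le_one _))

theorem norm_branchSum_le {a : ℝ} (ha : 0 < a) (ha' : a ≤ 1 / 2) (m : ℕ) {θ : ℝ}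
    (hθ : |θ| ≤ Real.pi) : ‖branchSum a m θ‖ ≤ (branchSum a m 0).re := by
  wlog h0 : 0 ≤ θ generalizing θ
  · have h := this (θ := -θ) (by rwa [abs_neg]) (by linarith)
    rwa [branchSum_neg, Complex.norm_conj] at h
  rw [abs_of_nonneg h0] at hθ
  have hd : ∀ t, HasDerivAt (fun t => (branchSum a m t).re ^ 2 + (branchSum a m t).im ^ 2)
      (-(2 * (branchSum a m t).im * Real.sin (t / 2) ^ (2 * m))) t := by
    intro t
    refine (((hasDerivAt_branchSum_re ha ha' m t).pow 2).add
      ((hasDerivAt_branchSum_im ha ha' m t).pow 2)).congr_deriv ?_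
    push_cast
    ring
  have hanti := antitoneOn_of_deriv_nonpos (convex_Icc 0 Real.pi)
    (fun t _ => (hd t).continuousAt.continuousWithinAt)
    (fun t _ => (hd t).differentiableAt.differentiableWithinAt)
    (fun t ht => by
      have ht' := interior_subset ht
      rw [(hd t).deriv]
      have h1 := branchSum_im_nonneg ha ha' m ht'
      have h2 := sin_half_nonneg ht'
      exact neg_nonpos.mpr (by positivity))
  have h := hanti (Set.left_mem_Icc.mpr Real.pi_pos.le) ⟨h0, hθ⟩ h0
  simp only [branchSum_zero_im] at h
  have hpos : 0 ≤ (branchSum a m 0).re :=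
    le_trans (by positivity) (one_div_le_branchSum_zero_re ha ha' m)
  rw [Complex.norm_def, Complex.normSq_apply]
  apply Real.sqrt_le_iff.mpr ⟨hpos, ?_⟩
  nlinarith

/-- Variation of constants: e^{-iaθ}F has derivative of modulus sin^{2m}(θ/2), which increases on
[0, π]. -/
theorem norm_branchSum_sub_le {a : ℝ} (ha : 0 < a) (ha' : a ≤ 1 / 2) (m : ℕ) {θ : ℝ}
    (hθ : |θ| ≤ Real.pi) :
    ‖branchSum a m θ - (branchSum a m 0).re * Complex.exp (Complex.I * (a * θ))‖ ≤
      Real.pi * Real.sin (θ / 2) ^ (2 * m) := by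
  wlog h0 : 0 ≤ θ generalizing θ
  · have h := this (θ := -θ) (by rwa [abs_neg]) (by linarith)
    rw [branchSum_neg, neg_div, Real.sin_neg, (even_two_mul m).neg_pow,
      ← Complex.norm_conj, map_sub, map_mul, ← Complex.exp_conj] at h
    simpa using h
  rw [abs_of_nonneg h0] at hθ
  have hlin : ∀ t : ℝ, HasDerivAt (fun t : ℝ => -Complex.I * (a * (t : ℂ))) (-Complex.I * a) t :=
    fun t => by
      simpa using ((Complex.ofRealCLM.hasDerivAt (x := t)).const_mul (a : ℂ)).const_mul
        (-Complex.I)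
  have hd : ∀ t : ℝ, HasDerivAt
      (fun t : ℝ => Complex.exp (-Complex.I * (a * (t : ℂ))) * branchSum a m t)
      (-Complex.I * Complex.exp (-Complex.I * (a * (t : ℂ))) *
        (Real.sin (t / 2) ^ (2 * m) : ℝ)) t := by
    intro t
    refine ((hlin t).cexp.mul (hasDerivAt_branchSum ha ha' m t)).congr_deriv ?_
    ring
  have hexp : ∀ t : ℝ, ‖Complex.exp (-Complex.I * (a * (t : ℂ)))‖ = 1 := fun t => by
    rw [show -Complex.I * (a * (t : ℂ)) = ((-(a * t) : ℝ) : ℂ) * Complex.I by push_cast; ring,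
      Complex.norm_exp_ofReal_mul_I]
  have h := Convex.norm_image_sub_le_of_norm_hasDerivWithin_le (𝕜 := ℝ) (s := Set.Icc 0 θ)
    (C := Real.sin (θ / 2) ^ (2 * m)) (fun t _ => (hd t).hasDerivWithinAt)
    (fun t ht => by
      have hs := sin_half_nonneg ⟨ht.1, ht.2.trans hθ⟩
      rw [norm_mul, norm_mul, hexp, norm_neg, Complex.norm_I, one_mul, one_mul, Complex.norm_real,
        Real.norm_of_nonneg (pow_nonneg hs _)]
      apply pow_le_pow_left₀ hs
      apply Real.sin_le_sin_of_le_of_le_pi_div_two <;> linarith [ht.1, ht.2])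
    (convex_Icc 0 θ) (Set.left_mem_Icc.mpr h0) (Set.right_mem_Icc.mpr h0)
  have hF0 : branchSum a m 0 = (branchSum a m 0).re := by
    apply Complex.ext <;> simp [branchSum_zero_im]
  have heq : branchSum a m θ - (branchSum a m 0).re * Complex.exp (Complex.I * (a * θ)) =
      Complex.exp (Complex.I * (a * θ)) *
        (Complex.exp (-Complex.I * (a * (θ : ℂ))) * branchSum a m θ -
          Complex.exp (-Complex.I * (a * ((0 : ℝ) : ℂ))) * branchSum a m 0) := by
    have h1 : Complex.exp (Complex.I * (a * θ)) * Complex.exp (-Complex.I * (a * θ)) = 1 := by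
      rw [neg_mul, Complex.exp_neg, mul_inv_cancel₀ (Complex.exp_ne_zero _)]
    have h2 : Complex.exp (-Complex.I * (a * ((0 : ℝ) : ℂ))) = 1 := by simp
    rw [← hF0, h2]
    linear_combination -branchSum a m θ * h1
  have hn : ‖Complex.exp (Complex.I * (a * θ))‖ = 1 := by
    rw [show Complex.I * (a * (θ : ℂ)) = ((a * θ : ℝ) : ℂ) * Complex.I by push_cast; ring,
      Complex.norm_exp_ofReal_mul_I]
  rw [heq, norm_mul, hn, one_mul]
  refine h.trans ?_
  rw [sub_zero, Real.norm_of_nonneg h0, mul_comm]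
  exact mul_le_mul_of_nonneg_right hθ (pow_nonneg (sin_half_nonneg ⟨h0, hθ⟩) _)

end BranchApproximation

/-! ### Normalization and error estimates. -/

section Approximation

open Polynomial

/-- The polynomial with coefficients `branchCoeff a m`. -/
noncomputable def branchPoly (a : ℝ) (m : ℕ) : ℝ[X] :=
  ∑ l ∈ Finset.range (2 * m + 1), C (branchCoeff a m l) * X ^ l

theorem natDegree_branchPoly_le (a : ℝ) (m : ℕ) : (branchPoly a m).natDegree ≤ 2 * m :=
  natDegree_sum_le_of_forall_le _ _ fun l hl =>
    (natDegree_C_mul_X_pow_le _ _).trans (by simpa [Nat.lt_succ_iff] using hl)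

theorem aeval_branchPoly (a : ℝ) (m : ℕ) (θ : ℝ) :
    aeval (Complex.exp (Complex.I * θ)) (branchPoly a m) =
      Complex.exp (Complex.I * θ) ^ m * branchSum a m θ := by
  rw [branchPoly, branchSum, map_sum, Finset.mul_sum]
  refine Finset.sum_congr rfl fun l _ => ?_
  rw [map_mul, map_pow, aeval_X, aeval_C, mul_left_comm, Complex.coe_algebraMap,
    ← Complex.exp_nat_mul, ← Complex.exp_nat_mul, ← Complex.exp_add]
  congr 2
  push_cast
  ring

theorem norm_exp_I_mul_ofReal (θ : ℝ) : ‖Complex.exp (Complex.I * θ)‖ = 1 := by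
  rw [mul_comm, Complex.norm_exp_ofReal_mul_I]

theorem norm_laurentEval (k : ℕ) (f : ℝ[X]) (φ : ℝ) :
    ‖laurentEval k f φ‖ = ‖aeval (Complex.exp (Complex.I * φ) ^ 2) f‖ := by
  rw [laurentEval, norm_mul, norm_zpow, norm_exp_I_mul_ofReal, one_zpow, one_mul]

theorem exp_I_mul_sq (φ : ℝ) :
    Complex.exp (Complex.I * φ) ^ 2 = Complex.exp (Complex.I * ((2 * φ : ℝ) : ℂ)) := by
  rw [← Complex.exp_nat_mul]
  congr 1
  push_cast
  ring

theorem laurentEval_branchPoly (a : ℝ) (m : ℕ) (φ : ℝ) :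
    laurentEval (2 * m) (branchPoly a m) φ = branchSum a m (2 * φ) := by
  rw [laurentEval, exp_I_mul_sq, aeval_branchPoly, ← exp_I_mul_sq, ← mul_assoc, ← pow_mul,
    ← zpow_natCast, ← zpow_add₀ (Complex.exp_ne_zero _)]
  simp

/-- Polynomial approximation of the branch `w ↦ w ^ a` on the unit circle, strictly bounded by
one. -/
theorem exists_polynomial_approx {a : ℝ} (ha : 0 < a) (ha' : a ≤ 1 / 2) (m : ℕ) {η : ℝ}
    (hη : 0 < η) (hη' : η < 1) :
    ∃ f : ℝ[X], f.natDegree ≤ 2 * m ∧ (∀ w : ℂ, ‖w‖ = 1 → ‖aeval w f‖ < 1) ∧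
      ∀ φ : ℝ, |φ| ≤ Real.pi / 2 →
        ‖laurentEval (2 * m) f φ - Complex.exp (Complex.I * (2 * a * φ : ℝ))‖ ≤
          η + ((m : ℝ) + 1) * (Real.pi * Real.sin φ ^ (2 * m)) := by
  set κ := (branchSum a m 0).re with hκdef
  have hκ : 1 / ((m : ℝ) + 1) ≤ κ := one_div_le_branchSum_zero_re ha ha' m
  have hm : 0 < (m : ℝ) + 1 := by positivity
  have hκ0 : 0 < κ := lt_of_lt_of_le (by positivity) hκ
  have hκinv : κ⁻¹ ≤ (m : ℝ) + 1 := by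
    rw [one_div] at hκ
    exact inv_le_of_inv_le₀ hm hκ
  -- The factor 1 - η makes the bound on the circle strict, as the strict Fejér–Riesz theorem
  -- requires.
  refine ⟨C ((1 - η) / κ) * branchPoly a m,
    (natDegree_C_mul_le _ _).trans (natDegree_branchPoly_le a m), ?_, ?_⟩
  · intro w hw
    have hw' : w = Complex.exp (Complex.I * (Complex.arg w : ℂ)) := by
      have h := Complex.norm_mul_exp_arg_mul_I w
      rw [hw, Complex.ofReal_one, one_mul, mul_comm] at h
      exact h.symm
    rw [hw', map_mul, aeval_C, aeval_branchPoly, norm_mul, norm_mul, norm_pow,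
      norm_exp_I_mul_ofReal, one_pow, one_mul, Complex.coe_algebraMap, Complex.norm_real,
      Real.norm_of_nonneg (div_nonneg (by linarith) hκ0.le), div_mul_eq_mul_div, div_lt_one hκ0]
    have h := norm_branchSum_le ha ha' m (Complex.abs_arg_le_pi w)
    calc (1 - η) * ‖branchSum a m w.arg‖ ≤ (1 - η) * κ :=
          mul_le_mul_of_nonneg_left h (by linarith)
      _ < κ := by nlinarith
  · intro φ hφ
    have hφ' : |2 * φ| ≤ Real.pi := by
      rw [abs_mul, abs_two]
      linarith
    have h := norm_branchSum_sub_le ha ha' m hφ'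
    rw [mul_div_cancel_left₀ _ two_ne_zero] at h
    have hE : Complex.exp (Complex.I * (2 * a * φ : ℝ)) =
        Complex.exp (Complex.I * (a * ((2 * φ : ℝ) : ℂ))) := by
      congr 1
      push_cast
      ring
    have hEn : ‖Complex.exp (Complex.I * (2 * a * φ : ℝ))‖ = 1 := norm_exp_I_mul_ofReal _
    have hL : laurentEval (2 * m) (C ((1 - η) / κ) * branchPoly a m) φ =
        ((1 - η) / κ : ℝ) * branchSum a m (2 * φ) := by
      rw [← laurentEval_branchPoly, laurentEval, laurentEval, map_mul, aeval_C]
      simp only [Complex.coe_algebraMap]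
      ring
    have hκc : (κ : ℂ) ≠ 0 := by exact_mod_cast hκ0.ne'
    have hsplit : laurentEval (2 * m) (C ((1 - η) / κ) * branchPoly a m) φ -
        Complex.exp (Complex.I * (2 * a * φ : ℝ)) =
        -((η : ℂ) * Complex.exp (Complex.I * (2 * a * φ : ℝ))) + ((1 - η) / κ : ℝ) *
          (branchSum a m (2 * φ) - κ * Complex.exp (Complex.I * (2 * a * φ : ℝ))) := by
      rw [hL]
      push_cast
      field_simp
      ring
    rw [hsplit]
    refine (norm_add_le _ _).trans (add_le_add ?_ ?_)
    · rw [norm_neg, norm_mul, hEn, mul_one, Complex.norm_real, Real.norm_of_nonneg hη.le]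
    · rw [norm_mul, Complex.norm_real, hE, Real.norm_of_nonneg (div_nonneg (by linarith) hκ0.le)]
      refine mul_le_mul ?_ h (norm_nonneg _) hm.le
      rw [div_eq_mul_inv]
      exact (mul_le_of_le_one_left (inv_nonneg.mpr hκ0.le) (by linarith)).trans hκinv

theorem norm_quaternionMatrix_sq (u v : ℂ) :
    ‖quaternionMatrix u v‖ ^ 2 = ‖u‖ ^ 2 + ‖v‖ ^ 2 := by
  have h : quaternionMatrix u v * star (quaternionMatrix u v) =
      ((‖u‖ ^ 2 + ‖v‖ ^ 2 : ℝ) : ℂ) • (1 : Matrix (Fin 2) (Fin 2) ℂ) := by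
    have hu := Complex.mul_conj u
    have hv := Complex.mul_conj v
    rw [Complex.normSq_eq_norm_sq] at hu hv
    push_cast at hu hv
    ext i j
    fin_cases i <;> fin_cases j <;>
      simp [quaternionMatrix, Matrix.mul_apply, Fin.sum_univ_two, Matrix.star_apply] <;>
      first
      | linear_combination hu + hv - v * starRingEnd ℂ v * Complex.I_sq
      | ring
  rw [sq, ← CStarRing.norm_self_mul_star, h, norm_smul, norm_one, mul_one, Complex.norm_real,
    Real.norm_of_nonneg (by positivity)]

theorem norm_sq_laurentEval_add {k : ℕ} {f g : ℝ[X]} (hf : f.natDegree ≤ k)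
    (hg : g.natDegree ≤ k) (h : f * reflect k f + g * reflect k g = X ^ k) (φ : ℝ) :
    ‖laurentEval k f φ‖ ^ 2 + ‖laurentEval k g φ‖ ^ 2 = 1 := by
  rw [norm_laurentEval, norm_laurentEval]
  set w := Complex.exp (Complex.I * φ) ^ 2 with hw
  have hwn : ‖w‖ = 1 := by rw [hw, norm_pow, norm_exp_I_mul_ofReal, one_pow]
  have hw0 : w ≠ 0 := by
    rw [← norm_pos_iff, hwn]
    exact one_pos
  have e := congrArg (aeval w) h
  rw [map_add, map_mul, map_mul, aeval_reflect_of_norm_eq_one hf hwn,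
    aeval_reflect_of_norm_eq_one hg hwn, mul_left_comm, mul_left_comm (aeval w g),
    Complex.mul_conj, Complex.mul_conj, ← mul_add, map_pow, aeval_X,
    Complex.normSq_eq_norm_sq, Complex.normSq_eq_norm_sq] at e
  have e' := mul_left_cancel₀ (pow_ne_zero k hw0) (e.trans (mul_one _).symm)
  exact_mod_cast e'

/-- The squared norm is |F - e^{iα}|² + |G|², and |G|² = 1 - |F|² is controlled only to first order
by |F - e^{iα}|; hence a linear bound on the square. -/
theorem norm_quaternionMatrix_sub_zRotation_sq_le {F G : ℂ} (h : ‖F‖ ^ 2 + ‖G‖ ^ 2 = 1) (α : ℝ) :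
    ‖quaternionMatrix F G - zRotation α‖ ^ 2 ≤ 3 * ‖F - Complex.exp (Complex.I * α)‖ := by
  have hconj : starRingEnd ℂ (Complex.exp (Complex.I * α)) = Complex.exp (-(Complex.I * α)) := by
    rw [← Complex.exp_conj]
    simp
  have hsub : quaternionMatrix F G - zRotation α =
      quaternionMatrix (F - Complex.exp (Complex.I * α)) G := by
    rw [zRotation_eq, quaternionMatrix, quaternionMatrix, map_sub, hconj]
    ext i j
    fin_cases i <;> fin_cases j <;> simp
  rw [hsub, norm_quaternionMatrix_sq]
  have h1 := norm_exp_I_mul_ofReal α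
  have h2 : 1 - ‖F‖ ≤ ‖F - Complex.exp (Complex.I * α)‖ := by
    rw [← h1, norm_sub_rev]
    exact norm_sub_norm_le _ _
  have h3 : ‖F - Complex.exp (Complex.I * α)‖ ≤ ‖F‖ + 1 := by
    rw [← h1]
    exact norm_sub_le _ _
  have h4 := norm_nonneg F
  have h5 : ‖F‖ ≤ 1 := by nlinarith [sq_nonneg ‖G‖]
  have h8 : ‖F‖ ^ 2 ≥ 1 - 2 * ‖F - Complex.exp (Complex.I * α)‖ +
      ‖F - Complex.exp (Complex.I * α)‖ ^ 2 - ‖F - Complex.exp (Complex.I * α)‖ := by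
    set u := ‖F - Complex.exp (Complex.I * α)‖
    nlinarith
  nlinarith

theorem one_le_log_scale {δ ε : ℝ} (hδ : 0 < δ) (hδ' : δ ≤ 1) (hε : 0 < ε) (hε' : ε ≤ 1 / 2) :
    1 ≤ Real.log (ε ^ (-2 : ℤ) * δ ^ (-(1 / 2) : ℝ)) := by
  have h1 : (4 : ℝ) ≤ ε ^ (-2 : ℤ) := by
    rw [zpow_neg, le_inv_comm₀ (by norm_num) (by positivity)]
    norm_cast
    nlinarith
  have h2 : 1 ≤ δ ^ (-(1 / 2) : ℝ) :=
    Real.one_le_rpow_of_pos_of_le_one_of_nonpos hδ hδ' (by norm_num)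
  rw [Real.le_log_iff_exp_le (by positivity)]
  nlinarith [Real.exp_one_lt_d9]

theorem tail_bound {δ ε : ℝ} (hδ : 0 < δ) (hδ' : δ ≤ 1) (hε : 0 < ε) (hε' : ε ≤ 1 / 2) {m : ℕ}
    (hm : 16 * (δ ^ (-2 : ℤ) * Real.log (ε ^ (-2 : ℤ) * δ ^ (-(1 / 2) : ℝ))) ≤ m) :
    ((m : ℝ) + 1) * (Real.pi * (1 - δ ^ 2) ^ m) ≤ ε ^ 2 / 6 := by
  set L := Real.log (ε ^ (-2 : ℤ) * δ ^ (-(1 / 2) : ℝ)) with hL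
  have hexpL : Real.exp (-L) = ε ^ 2 * δ ^ (1 / 2 : ℝ) := by
    rw [Real.exp_neg, hL, Real.exp_log (by positivity), mul_inv, Real.rpow_neg hδ.le, inv_inv]
    simp
  have hexp8 : Real.exp (-(8 * L)) = ε ^ 16 * δ ^ 4 := by
    have h1 : Real.exp (-(8 * L)) = Real.exp (-L) ^ 8 := by
      rw [← Real.exp_nat_mul]
      congr 1
      push_cast
      ring
    have h2 : (δ ^ (1 / 2 : ℝ)) ^ 8 = δ ^ 4 := by
      rw [← Real.rpow_natCast, ← Real.rpow_mul hδ.le, ← Real.rpow_natCast]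
      norm_num
    rw [h1, hexpL, mul_pow, h2]
    ring
  have hL1 : 1 ≤ L := one_le_log_scale hδ hδ' hε hε'
  set y := (m : ℝ) * δ ^ 2 with hy
  have hyL : 16 * L ≤ y := by
    have h1 : δ ^ (-2 : ℤ) * δ ^ 2 = 1 := by
      rw [zpow_neg]
      norm_cast
      exact inv_mul_cancel₀ (by positivity)
    calc 16 * L = 16 * (δ ^ (-2 : ℤ) * L) * δ ^ 2 := by linear_combination -16 * L * h1
      _ ≤ y := mul_le_mul_of_nonneg_right hm (by positivity)
  have hpow : (1 - δ ^ 2) ^ m ≤ Real.exp (-y) := by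
    have h1 : (1 - δ ^ 2) ^ m ≤ Real.exp (-δ ^ 2) ^ m :=
      pow_le_pow_left₀ (by nlinarith) (Real.one_sub_le_exp_neg _) m
    rwa [← Real.exp_nat_mul, mul_neg] at h1
  -- Half of the exponent absorbs the factor y; the other half yields e^{-8L}, whose δ⁴ pays for m =
  -- yδ⁻².
  have hyexp : y * Real.exp (-y) ≤ 2 * (ε ^ 16 * δ ^ 4) := by
    have h1 : y / 2 ≤ Real.exp (y / 2) := by linarith [Real.add_one_le_exp (y / 2)]
    have h2 : Real.exp (-y) = Real.exp (-(y / 2)) * Real.exp (-(y / 2)) := by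
      rw [← Real.exp_add]
      congr 1
      ring
    have h3 : y / 2 * Real.exp (-(y / 2)) ≤ 1 := by
      rw [Real.exp_neg, ← div_eq_mul_inv]
      exact (div_le_one (Real.exp_pos _)).mpr h1
    have h4 : Real.exp (-(y / 2)) ≤ Real.exp (-(8 * L)) := Real.exp_le_exp.mpr (by linarith)
    rw [← hexp8, h2]
    nlinarith [Real.exp_pos (-(y / 2))]
  have hm1 : ((m : ℝ) + 1) * δ ^ 2 ≤ 2 * y := by nlinarith
  have hmain : ((m : ℝ) + 1) * Real.exp (-y) ≤ 4 * (ε ^ 16 * δ ^ 2) := by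
    apply le_of_mul_le_mul_right _ (show 0 < δ ^ 2 by positivity)
    calc ((m : ℝ) + 1) * Real.exp (-y) * δ ^ 2 = ((m : ℝ) + 1) * δ ^ 2 * Real.exp (-y) := by ring
      _ ≤ 2 * y * Real.exp (-y) := mul_le_mul_of_nonneg_right hm1 (Real.exp_pos _).le
      _ ≤ 4 * (ε ^ 16 * δ ^ 2) * δ ^ 2 := by linarith
  have hε14 : ε ^ 14 ≤ (1 / 2) ^ 14 := pow_le_pow_left₀ hε.le hε' 14
  have hδ2 : δ ^ 2 ≤ 1 := pow_le_one₀ hδ.le hδ'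
  have hsmall : 4 * (ε ^ 16 * δ ^ 2) ≤ ε ^ 2 / 24 := by
    have h1 : ε ^ 16 * δ ^ 2 ≤ ε ^ 16 := mul_le_of_le_one_right (by positivity) hδ2
    have h2 : ε ^ 16 = ε ^ 2 * ε ^ 14 := by ring
    have h3 : ε ^ 2 * ε ^ 14 ≤ ε ^ 2 * (1 / 2) ^ 14 :=
      mul_le_mul_of_nonneg_left hε14 (by positivity)
    nlinarith [sq_nonneg ε]
  calc ((m : ℝ) + 1) * (Real.pi * (1 - δ ^ 2) ^ m)
      ≤ ((m : ℝ) + 1) * (Real.pi * Real.exp (-y)) := by gcongr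
    _ = Real.pi * (((m : ℝ) + 1) * Real.exp (-y)) := by ring
    _ ≤ 4 * (ε ^ 2 / 24) :=
        mul_le_mul Real.pi_le_four (hmain.trans hsmall) (by positivity) (by norm_num)
    _ = ε ^ 2 / 6 := by ring

end Approximation

/-- The norm is the spectral norm (the operator norm induced by the Euclidean norm on `ℂ²`). -/
theorem mainTheorem9 :
    ∃ C : ℝ, 0 < C ∧ ∀ (n : ℕ) (δ ε : ℝ), 0 < δ → δ ≤ 1 → 0 < ε → ε ≤ 1 / 2 →
      ∃ (k : ℕ) (Φ : Fin (k + 1) → ℝ),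
        (k : ℝ) ≤ C * (δ ^ (-2 : ℤ) * Real.log (ε ^ (-2 : ℤ) * δ ^ (-(1 / 2) : ℝ))) ∧
        ∀ φ : ℝ, φ ∈ Set.Icc (-Real.pi) Real.pi → Real.cos φ ∈ Set.Icc δ 1 →
          ‖sigmaZQSPProtocol Φ (zRotation φ) - zRotation (φ / 2 ^ n)‖ ≤ ε := by
  -- The length is 2m < 2(16R + 1) ≤ 34R, because R ≥ 1.
  refine ⟨34, by norm_num, fun n δ ε hδ hδ' hε hε' => ?_⟩
  set R := δ ^ (-2 : ℤ) * Real.log (ε ^ (-2 : ℤ) * δ ^ (-(1 / 2) : ℝ)) with hR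
  have hR1 : 1 ≤ R := by
    have h1 : 1 ≤ δ ^ (-2 : ℤ) := by
      rw [zpow_neg]
      exact (one_le_inv₀ (by positivity)).mpr (by norm_cast; exact pow_le_one₀ hδ.le hδ')
    exact one_le_mul_of_one_le_of_one_le h1 (one_le_log_scale hδ hδ' hε hε')
  set m := ⌈16 * R⌉₊ with hm
  have hm1 : 16 * R ≤ m := Nat.le_ceil _
  have hm2 : (m : ℝ) < 16 * R + 1 := Nat.ceil_lt_add_one (by linarith)
  have ha : (0 : ℝ) < 1 / (2 * 2 ^ n) := by positivity
  have ha' : (1 : ℝ) / (2 * 2 ^ n) ≤ 1 / 2 := by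
    apply one_div_le_one_div_of_le two_pos
    linarith [one_le_pow₀ (M₀ := ℝ) one_le_two (n := n)]
  -- The shrinkage and the tail each contribute ε²/6; their sum ε²/3 offsets the factor 3 in
  -- `norm_quaternionMatrix_sub_zRotation_sq_le`.
  obtain ⟨f, hf, hlt, happrox⟩ := exists_polynomial_approx ha ha' m (η := ε ^ 2 / 6)
    (by positivity) (by nlinarith)
  obtain ⟨g, hg, hfg⟩ := exists_complementary_polynomial hf hlt
  obtain ⟨Φ, hΦ⟩ := exists_phases hf hg hfg
  refine ⟨2 * m, Φ, by push_cast; linarith, fun φ hφ hcos => ?_⟩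
  have hφ' : |φ| ≤ Real.pi / 2 := by
    by_contra! h
    have h1 := Real.cos_neg_of_pi_div_two_lt_of_lt h
      (by linarith [abs_le.mpr hφ, Real.pi_pos] : |φ| < Real.pi + Real.pi / 2)
    rw [Real.cos_abs] at h1
    linarith [hcos.1]
  have hsin : Real.sin φ ^ (2 * m) ≤ (1 - δ ^ 2) ^ m := by
    rw [pow_mul]
    apply pow_le_pow_left₀ (sq_nonneg _)
    nlinarith [Real.sin_sq_add_cos_sq φ, hcos.1]
  have herr : ‖laurentEval (2 * m) f φ - Complex.exp (Complex.I * (φ / 2 ^ n : ℝ))‖ ≤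
      ε ^ 2 / 6 + ε ^ 2 / 6 := by
    have h1 := happrox φ hφ'
    rw [show 2 * (1 / (2 * 2 ^ n)) * φ = φ / 2 ^ n by field_simp] at h1
    refine h1.trans (add_le_add le_rfl (le_trans ?_ (tail_bound hδ hδ' hε hε' hm1)))
    gcongr
  rw [hΦ]
  have h2 := norm_quaternionMatrix_sub_zRotation_sq_le (norm_sq_laurentEval_add hf hg hfg φ)
    (φ / 2 ^ n)
  exact (pow_le_pow_iff_left₀ (norm_nonneg _) hε.le two_ne_zero).mp (by linarith)
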